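/- Let $n\ge 1$, let $\Omega\subset\mathbb{R}^n$ be a bounded domain (a nonempty bounded connected open set), and let $\delta\in(0,\infty)$. For $\sigma\in(0,1)$ let $H^\sigma_\Omega(\mathbb{R}^n)$ be the space of all $v\in L^2(\mathbb{R}^n)$ with $v=0$ a.e. on $\mathbb{R}^n\setminus\Omega$ and $$\|v\|_{H^\sigma_\Omega(\mathbb{R}^n)}:=\Big(\int_{\mathbb{R}^n}\int_{\mathbb{R}^n}\frac{|v(x)-v(y)|^2}{|x-y|^{n+2\sigma}}\,dy\,dx\Big)^{1/2}<\infty ,$$ and set $$a(u,v;s,\delta):=\int_{\{|x-y|\le\delta\}}\frac{(u(x)-u(y))(v(x)-v(y))}{|x-y|^{n+2s}}\,d(x,y),$$ $$a'_s(u,v;s,\delta):=-2\int_{\{|x-y|\le\delta\}}\frac{(u(x)-u(y))(v(x)-v(y))\log|x-y|}{|x-y|^{n+2s}}\,d(x,y).$$ For every $\varepsilon_0>0$ there is a constant $C>0$, depending only on $n$, $\Omega$, $\delta$ and $\varepsilon_0$, such that the following holds. Let $\mathcal S_k=[s_{\min,k},s_{\max,k}]\subset(0,1)$ with $s_{\min,k}<s_{\max,k}$,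 and let $s_{1,k},s_{2,k}\in(0,1)$ satisfy $$\frac{s_{1,k}+s_{2,k}}{2}-\frac12<s_{\max,k}<\frac{s_{1,k}+s_{2,k}}{2},\qquad \hat\varepsilon(s_{\max,k})\ge\varepsilon_0,\qquad\text{where }\hat\varepsilon(s):=s_{1,k}+s_{2,k}-2s .$$ Let $M>2$ be an integer, let $s_0,\dots,s_M$ be the Chebyshev nodes on $\mathcal S_k$, that is, the images under the increasing affine map $[-1,1]\to\mathcal S_k$ of either $\cos(m\pi/M)$ or $\cos\big((2m+1)\pi/(2M+2)\big)$, $0\le m\le M$, let $\Theta_{\mathcal S_k,m}$ be the corresponding Lagrange basis polynomials, and put $$\tilde a'_s(u,v;s,\delta):=\sum_{m=0}^{M}\Theta'_{\mathcal S_k,m}(s)\,a(u,v;s_m,\delta).$$ Then for all $u\in H^{s_{2,k}}_\Omega(\mathbb{R}^n)$, $v\in H^{s_{1,k}}_\Omega(\mathbb{R}^n)$ and $s\in\mathcal S_k$, the function $r\mapsto a(u,v;r,\delta)$ is differentiable at $s$ with derivative $a'_s(u,v;s,\delta)$, and $$\big|a'_s(u,v;s,\delta)-\tilde a'_s(u,v;s,\delta)\big|\le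 C\,\tilde\sigma_k^{M}M^2\,\|u\|_{H^{s_{2,k}}_\Omega(\mathbb{R}^n)}\|v\|_{H^{s_{1,k}}_\Omega(\mathbb{R}^n)},\qquad \tilde\sigma_k:=\frac{s_{\max,k}-s_{\min,k}}{\hat\varepsilon(s_{\max,k})}.$$ -/

import Mathlib

open MeasureTheory

noncomputable section

/-- The squared Gagliardo seminorm of order `s` on `ℝⁿ`, with values in `[0, ∞]`:
`∫∫ |v(x) - v(y)|² / |x - y|^(n + 2s) dy dx`. -/
def gagliardoSq {n : ℕ} (s : ℝ) (v : EuclideanSpace ℝ (Fin n) → ℝ) : ENNReal :=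
  ∫⁻ p : EuclideanSpace ℝ (Fin n) × EuclideanSpace ℝ (Fin n),
    ENNReal.ofReal (|v p.1 - v p.2| ^ 2 / ‖p.1 - p.2‖ ^ ((n : ℝ) + 2 * s))

/-- Membership in `H^s_Ω(ℝⁿ)` for `s ∈ (0, 1)`: square-integrable functions on `ℝⁿ` with finite
Gagliardo seminorm that vanish (almost everywhere) outside `Ω`. -/
structure MemSobolevOmega {n : ℕ} (Ω : Set (EuclideanSpace ℝ (Fin n))) (s : ℝ)
    (v : EuclideanSpace ℝ (Fin n) → ℝ) : Prop where
  memLp : MemLp v 2 volume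
  gagliardo_lt_top : gagliardoSq s v < ⊤
  vanish : ∀ᵐ x, x ∉ Ω → v x = 0

/-- The norm of `H^s_Ω(ℝⁿ)`, which is the Gagliardo seminorm of `H^s(ℝⁿ)`. -/
def sobolevOmegaNorm {n : ℕ} (s : ℝ) (v : EuclideanSpace ℝ (Fin n) → ℝ) : ℝ :=
  Real.sqrt (gagliardoSq s v).toReal

/-- The strip `S_δ = {(x, y) : |x - y| ≤ δ}` in `ℝⁿ × ℝⁿ`. -/
def interactionStrip (n : ℕ) (δ : ℝ) :
    Set (EuclideanSpace ℝ (Fin n) × EuclideanSpace ℝ (Fin n)) :=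
  {p | ‖p.1 - p.2‖ ≤ δ}

/-- The truncated fractional bilinear form
`a(u, v; s, δ) = ∫_{S_δ} (u(x) - u(y)) (v(x) - v(y)) / |x - y|^(n + 2s) d(x, y)`. -/
def nonlocalForm {n : ℕ} (u v : EuclideanSpace ℝ (Fin n) → ℝ) (s δ : ℝ) : ℝ :=
  ∫ p in interactionStrip n δ,
    (u p.1 - u p.2) * (v p.1 - v p.2) / ‖p.1 - p.2‖ ^ ((n : ℝ) + 2 * s)

/-- The `s`-derivative of the form,
`a'_s(u, v; s, δ) = -2 ∫_{S_δ} (u(x) - u(y)) (v(x) - v(y)) log |x - y| / |x - y|^(n + 2s) d(x, y)`.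
-/
def nonlocalFormDerivS {n : ℕ} (u v : EuclideanSpace ℝ (Fin n) → ℝ) (s δ : ℝ) : ℝ :=
  -2 * ∫ p in interactionStrip n δ,
    (u p.1 - u p.2) * (v p.1 - v p.2) * Real.log ‖p.1 - p.2‖
      / ‖p.1 - p.2‖ ^ ((n : ℝ) + 2 * s)

/-- `t` is one of the two standard families of `M + 1` Chebyshev nodes on `[a, b]` (`M ≥ 1`): the
extreme points of `T_M` or the roots of `T_(M + 1)`, transported from `[-1, 1]` to `[a, b]`. -/
def IsChebyshevNodes (a b : ℝ) (M : ℕ) (t : Fin (M + 1) → ℝ) : Prop :=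
  (∀ m, t m = (a + b) / 2 + (b - a) / 2 * Real.cos ((m : ℕ) * Real.pi / M)) ∨
  (∀ m, t m = (a + b) / 2
    + (b - a) / 2 * Real.cos ((2 * ((m : ℕ) : ℝ) + 1) * Real.pi / (2 * ((M : ℝ) + 1))))

/-- The derivative at `s` of the polynomial interpolant in `s`, at the nodes `t`, of the form:
`ã'_s(u, v; s, δ) = ∑_m Θ'_m(s) a(u, v; t_m, δ)` with `Θ_m` the Lagrange basis polynomials. -/
def interpFormDerivS {n M : ℕ} (t : Fin (M + 1) → ℝ) (u v : EuclideanSpace ℝ (Fin n) → ℝ)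
    (s δ : ℝ) : ℝ :=
  ∑ m : Fin (M + 1),
    (Polynomial.derivative (Lagrange.basis Finset.univ t m)).eval s * nonlocalForm u v (t m) δ

end

/-! With `σ = (s₁ + s₂) / 2` and `ρ = |x - y|`, the integrand of the form at order `r` is
`W * exp (2 log ρ (σ - r))`, where `W` is the product of the Gagliardo quotients of `u` and `v`. By
Cauchy-Schwarz `∫ |W|` is at most the product of the two norms
(`MemSobolevOmega.integral_abs_mul_le`), so everything reduces to estimates for the single
exponential `r ↦ exp (2 l (σ - r))`, uniform over `l = log ρ ≤ log (max 1 δ)`. Differentiability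
under the integral sign is `hasDerivAt_integral_mul_exp`.

The error of differentiating the interpolant is a linear functional `E` (`diffRuleError`) that
vanishes on polynomials of degree at most `M`. After an affine change of variables to `[-1, 1]` it
satisfies `|E (X ^ k)| ≤ 2 k ^ 2` for `k ≥ M` (`abs_diffRuleError_X_pow_le`): `X ^ k` is a convex
combination of the Chebyshev polynomials `T_j` with `j ≤ k`, one has `|T_j'| ≤ j ^ 2`, and at the
nodes every `T_j` is aliased to `0` or to some `± T_i` with `i ≤ M`, whose interpolant is itself.
No Lebesgue constant is involved, hence no logarithm of `M`.

Expanding `exp (τ y)` in powers of `y` and applying `E` termwise bounds the error by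
`4 |τ| ^ (M + 1) / (M - 1)! * exp |τ|` (`abs_diffRuleError_exp_le`), where `τ = -l (b - a)` and
`[a, b]` is the interval of orders. The factor `exp (2 l (σ - (a + b) / 2))` at the midpoint absorbs
`exp |τ|` if `l < 0` and leaves `exp (-2 |l| (σ - b))`; since
`x ^ (M + 1) exp (-x) ≤ (M + 1)!` for `x = 2 |l| (σ - b)`, this gives
`O (M ^ 2 * ((b - a) / (2 (σ - b))) ^ M)` uniformly in `l` (`abs_deriv_exp_sub_interp_le`).
For `l ≥ 0` the exponentials are bounded by a power of `max 1 δ`. -/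

/-! ### Differentiation rules and Chebyshev polynomials -/

noncomputable section

/-- The error at `x₀` of the rule `p'(x₀) ≈ ∑ m, w m * p (x m)` for numerical differentiation, as a
linear functional on polynomials. -/
def diffRuleError {ι : Type*} [Fintype ι] (x w : ι → ℝ) (x₀ : ℝ) : Polynomial ℝ →ₗ[ℝ] ℝ :=
  (Polynomial.leval x₀).comp Polynomial.derivative - ∑ m, w m • Polynomial.leval (x m)

end

lemma diffRuleError_apply {ι : Type*} [Fintype ι] (x w : ι → ℝ) (x₀ : ℝ) (p : Polynomial ℝ) :
    diffRuleError x w x₀ p = p.derivative.eval x₀ - ∑ m, w m * p.eval (x m) := by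
  simp [diffRuleError, Polynomial.leval]

lemma abs_eval_derivative_T_le (k : ℤ) {x : ℝ} (hx : |x| ≤ 1) :
    |(Polynomial.derivative (Polynomial.Chebyshev.T ℝ k)).eval x| ≤ (k : ℝ) ^ 2 := by
  have h := Polynomial.Chebyshev.abs_iterate_derivative_T_real_le k 1 hx
  rw [Polynomial.Chebyshev.iterate_derivative_T_eval_one_eq_div] at h
  simpa using h

/-- A bound for a linear functional on Chebyshev polynomials up to degree `k` passes to `X ^ k`
because `X ^ k` is a convex combination of them. The induction runs over products `X ^ i * T_j`,
through `X * T_j = (T_(j+1) + T_(j-1)) / 2`. -/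
lemma abs_map_X_pow_mul_T_le (L : Polynomial ℝ →ₗ[ℝ] ℝ) (k : ℕ) (B : ℝ)
    (hL : ∀ j : ℤ, j.natAbs ≤ k → |L (Polynomial.Chebyshev.T ℝ j)| ≤ B) (i : ℕ) :
    ∀ j : ℤ, j.natAbs + i ≤ k → |L (Polynomial.X ^ i * Polynomial.Chebyshev.T ℝ j)| ≤ B := by
  induction i with
  | zero => intro j hj; simpa using hL j hj
  | succ i ih =>
    intro j hj
    have h1 := ih (j + 1) (by omega)
    have h2 := ih (j - 1) (by omega)
    have key : Polynomial.X ^ (i + 1) * Polynomial.Chebyshev.T ℝ j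
        = (1 / 2 : ℝ) • (Polynomial.X ^ i * Polynomial.Chebyshev.T ℝ (j + 1))
          + (1 / 2 : ℝ) • (Polynomial.X ^ i * Polynomial.Chebyshev.T ℝ (j - 1)) := by
      have h2 : (2 : Polynomial ℝ) = Polynomial.C 2 := (map_ofNat Polynomial.C 2).symm
      rw [← smul_add, ← mul_add, Polynomial.Chebyshev.T_add_one, sub_add_cancel, h2,
        show Polynomial.X ^ i * (Polynomial.C 2 * Polynomial.X * Polynomial.Chebyshev.T ℝ j)
          = Polynomial.C 2 * (Polynomial.X ^ (i + 1) * Polynomial.Chebyshev.T ℝ j) by ring,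
        Polynomial.smul_eq_C_mul, ← mul_assoc, ← Polynomial.C_mul]
      norm_num
    rw [key, map_add, map_smul, map_smul, smul_eq_mul, smul_eq_mul]
    rw [abs_le] at h1 h2 ⊢
    constructor <;> linarith [h1.1, h1.2, h2.1, h2.2]

lemma abs_map_X_pow_le (L : Polynomial ℝ →ₗ[ℝ] ℝ) (k : ℕ) (B : ℝ)
    (hL : ∀ j : ℤ, j.natAbs ≤ k → |L (Polynomial.Chebyshev.T ℝ j)| ≤ B) :
    |L (Polynomial.X ^ k)| ≤ B := by
  simpa using abs_map_X_pow_mul_T_le L k B hL k 0 (by simp)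

/-! ### Chebyshev nodes -/

/-- Aliasing: at either family of Chebyshev nodes with `M + 1` points, `T_k` agrees up to sign with
`T_(k - 2 M)`, or with `T_(k - 2 (M + 1))`. The sign `ε` is `1` for the extreme points and `-1` for
the roots. -/
lemma IsChebyshevNodes.aliasing {M : ℕ} (hM : M ≠ 0) {x : Fin (M + 1) → ℝ}
    (hx : IsChebyshevNodes (-1) 1 M x) :
    (∀ (k : ℤ) m, (Polynomial.Chebyshev.T ℝ k).eval (x m)
        = (Polynomial.Chebyshev.T ℝ (k - 2 * M)).eval (x m)) ∨
    (∀ (k : ℤ) m, (Polynomial.Chebyshev.T ℝ k).eval (x m)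
        = -(Polynomial.Chebyshev.T ℝ (k - 2 * (M + 1))).eval (x m)) := by
  have hM' : (M : ℝ) ≠ 0 := by exact_mod_cast hM
  rcases hx with h | h
  · left
    intro k m
    rw [h m]
    simp only [neg_add_cancel, zero_div, sub_neg_eq_add, one_add_one_eq_two, ne_eq,
      OfNat.ofNat_ne_zero, not_false_eq_true, div_self, one_mul, zero_add,
      Polynomial.Chebyshev.T_real_cos]
    rw [← Real.cos_sub_nat_mul_two_pi _ (m : ℕ)]
    congr 1
    push_cast
    field_simp
  · right
    intro k m
    rw [h m]
    simp only [neg_add_cancel, zero_div, sub_neg_eq_add, one_add_one_eq_two, ne_eq,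
      OfNat.ofNat_ne_zero, not_false_eq_true, div_self, one_mul, zero_add,
      Polynomial.Chebyshev.T_real_cos]
    have hM1 : (M : ℝ) + 1 ≠ 0 := by positivity
    have key : (((k - 2 * (M + 1) : ℤ)) : ℝ) * ((2 * ((m : ℕ) : ℝ) + 1) * Real.pi / (2 * (M + 1)))
        = k * ((2 * ((m : ℕ) : ℝ) + 1) * Real.pi / (2 * (M + 1))) - (m : ℕ) * (2 * Real.pi)
          - Real.pi := by
      push_cast
      field_simp
      ring
    rw [key, Real.cos_sub_pi, Real.cos_sub_nat_mul_two_pi, neg_neg]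

/-- Both families of nodes are distinct: their angles lie in `[0, π]`, where the cosine is
injective. -/
lemma IsChebyshevNodes.injective {a b : ℝ} (hab : a < b) {M : ℕ} (hM : M ≠ 0)
    {t : Fin (M + 1) → ℝ} (ht : IsChebyshevNodes a b M t) : Function.Injective t := by
  have hM0 : (0 : ℝ) < M := by positivity
  have hh : (b - a) / 2 ≠ 0 := by linarith
  have hpi := Real.pi_pos
  intro i j hij
  have hi : ((i : ℕ) : ℝ) ≤ M := by exact_mod_cast Nat.lt_succ_iff.mp i.2
  have hj : ((j : ℕ) : ℝ) ≤ M := by exact_mod_cast Nat.lt_succ_iff.mp j.2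
  have hfin : ((i : ℕ) : ℝ) = (j : ℕ) → i = j := fun h => Fin.ext (by exact_mod_cast h)
  rcases ht with h | h
  · rw [h i, h j, add_right_inj, mul_right_inj' hh] at hij
    have := Real.injOn_cos ⟨by positivity, ?_⟩ ⟨by positivity, ?_⟩ hij
    · apply hfin
      field_simp at this
      exact this
    · rw [div_le_iff₀ hM0]; nlinarith
    · rw [div_le_iff₀ hM0]; nlinarith
  · rw [h i, h j, add_right_inj, mul_right_inj' hh] at hij
    have := Real.injOn_cos ⟨by positivity, ?_⟩ ⟨by positivity, ?_⟩ hij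
    · apply hfin
      field_simp at this
      linarith
    · rw [div_le_iff₀ (by positivity)]; nlinarith
    · rw [div_le_iff₀ (by positivity)]; nlinarith

lemma IsChebyshevNodes.mem_Icc {a b : ℝ} (hab : a < b) {M : ℕ}
    {t : Fin (M + 1) → ℝ} (ht : IsChebyshevNodes a b M t) (m : Fin (M + 1)) :
    t m ∈ Set.Icc a b := by
  have key : ∀ θ : ℝ, (a + b) / 2 + (b - a) / 2 * Real.cos θ ∈ Set.Icc a b := fun θ =>
    ⟨by nlinarith [Real.neg_one_le_cos θ], by nlinarith [Real.cos_le_one θ]⟩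
  rcases ht with h | h <;> rw [h m] <;> exact key _

lemma IsChebyshevNodes.normalize {a b : ℝ} (hab : a < b) {M : ℕ}
    {t : Fin (M + 1) → ℝ} (ht : IsChebyshevNodes a b M t) :
    IsChebyshevNodes (-1) 1 M (fun m => (t m - (a + b) / 2) / ((b - a) / 2)) := by
  have hh : (b - a) / 2 ≠ 0 := by linarith
  rcases ht with h | h
  · left; intro m; simp only [h m, add_sub_cancel_left, mul_div_cancel_left₀ _ hh]; ring
  · right; intro m; simp only [h m, add_sub_cancel_left, mul_div_cancel_left₀ _ hh]; ring

/-! ### Differentiation rules at Chebyshev nodes -/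

/-- A differentiation rule at Chebyshev nodes that is exact up to degree `M` has values at most
`M ^ 2` on all `T_k`: by aliasing it sees `T_k` as `± T_j` with `j ≤ M`, on which it is exact, or
as zero. -/
lemma abs_diffRule_T_le {M : ℕ} (hM : M ≠ 0) {x w : Fin (M + 1) → ℝ} {x₀ : ℝ}
    (hx : IsChebyshevNodes (-1) 1 M x) (hx₀ : |x₀| ≤ 1)
    (hexact : ∀ p : Polynomial ℝ, p.natDegree ≤ M → diffRuleError x w x₀ p = 0)
    (k : ℤ) : |∑ m, w m * (Polynomial.Chebyshev.T ℝ k).eval (x m)| ≤ (M : ℝ) ^ 2 := by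
  induction hd : k.natAbs using Nat.strong_induction_on generalizing k with
  | _ d ih =>
  by_cases hkM : k.natAbs ≤ M
  · have h0 := hexact (Polynomial.Chebyshev.T ℝ k) (by
      rw [Polynomial.Chebyshev.natDegree_T]; exact hkM)
    rw [diffRuleError_apply, sub_eq_zero] at h0
    rw [← h0]
    refine (abs_eval_derivative_T_le k hx₀).trans ?_
    rw [← sq_abs (k : ℝ)]
    have : |(k : ℝ)| ≤ M := by
      rw [← Int.cast_abs, Int.abs_eq_natAbs]
      exact_mod_cast hkM
    gcongr
  · have hT : Polynomial.Chebyshev.T ℝ k = Polynomial.Chebyshev.T ℝ (d : ℤ) := by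
      rw [← hd, Polynomial.Chebyshev.T_natAbs]
    rw [hT]
    rcases hx.aliasing hM with h | h
    · simp_rw [h d]
      exact ih _ (by omega) (d - 2 * M) rfl
    · rcases eq_or_ne d (M + 1) with hdM | hdM
      · have hz : ∀ m, (Polynomial.Chebyshev.T ℝ (d : ℤ)).eval (x m) = 0 := by
          intro m
          have h1 := h d m
          rw [show (d : ℤ) - 2 * (M + 1) = -d by rw [hdM]; push_cast; ring,
            Polynomial.Chebyshev.T_neg] at h1
          linarith
        simp only [hz, mul_zero, Finset.sum_const_zero, abs_zero]
        positivity
      · simp_rw [h d, mul_neg, Finset.sum_neg_distrib, abs_neg]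
        exact ih _ (by omega) (d - 2 * (M + 1)) rfl

lemma abs_diffRuleError_X_pow_le {M : ℕ} (hM : M ≠ 0) {x w : Fin (M + 1) → ℝ} {x₀ : ℝ}
    (hx : IsChebyshevNodes (-1) 1 M x) (hx₀ : |x₀| ≤ 1)
    (hexact : ∀ p : Polynomial ℝ, p.natDegree ≤ M → diffRuleError x w x₀ p = 0)
    {k : ℕ} (hk : M ≤ k) : |diffRuleError x w x₀ (Polynomial.X ^ k)| ≤ 2 * (k : ℝ) ^ 2 := by
  refine abs_map_X_pow_le _ k _ fun j hj => ?_
  rw [diffRuleError_apply]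
  have h1 := abs_eval_derivative_T_le j hx₀
  have h2 := abs_diffRule_T_le hM hx hx₀ hexact j
  have h3 : (j : ℝ) ^ 2 ≤ (k : ℝ) ^ 2 := by
    rw [← sq_abs (j : ℝ)]
    have : |(j : ℝ)| ≤ k := by
      rw [← Int.cast_abs, Int.abs_eq_natAbs]
      exact_mod_cast hj
    gcongr
  have h4 : (M : ℝ) ^ 2 ≤ (k : ℝ) ^ 2 := by gcongr
  exact (abs_sub _ _).trans (by linarith)

/-! ### The error on exponentials -/

/-- Applied to `y ↦ exp (τ y)`, the differentiation rule has as its error the power series in `τ` of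
its errors on monomials. -/
lemma hasSum_diffRuleError_exp {ι : Type*} [Fintype ι] (x w : ι → ℝ) (x₀ τ : ℝ) :
    HasSum (fun k : ℕ => τ ^ k / k.factorial * diffRuleError x w x₀ (Polynomial.X ^ k))
      (τ * Real.exp (τ * x₀) - ∑ m, w m * Real.exp (τ * x m)) := by
  have hexp : ∀ y : ℝ, HasSum (fun k : ℕ => y ^ k / k.factorial) (Real.exp y) := fun y => by
    rw [Real.exp_eq_exp_ℝ]; exact NormedSpace.expSeries_div_hasSum_exp y
  have hder : HasSum (fun k : ℕ => τ ^ k / k.factorial * (k * x₀ ^ (k - 1)))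
      (τ * Real.exp (τ * x₀)) := by
    rw [← hasSum_nat_add_iff' 1]
    simp only [Finset.range_one, Finset.sum_singleton, Nat.cast_zero, zero_mul, mul_zero, sub_zero]
    convert! (hexp (τ * x₀)).mul_left τ using 2 with k
    rw [Nat.factorial_succ, mul_pow, Nat.add_sub_cancel]
    have : ((k : ℝ) + 1) ≠ 0 := by positivity
    push_cast
    field_simp
    ring
  have hsum : HasSum (fun k : ℕ => ∑ m, w m * ((τ * x m) ^ k / k.factorial))
      (∑ m, w m * Real.exp (τ * x m)) :=
    hasSum_sum fun m _ => (hexp (τ * x m)).mul_left (w m)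
  convert! hder.sub hsum using 2 with k
  rw [diffRuleError_apply, mul_sub, Finset.mul_sum]
  congr 1
  · simp [Polynomial.derivative_X_pow]
  · refine Finset.sum_congr rfl fun m _ => ?_
    simp only [Polynomial.eval_pow, Polynomial.eval_X, mul_pow]
    ring

/-- For `M + 2` Chebyshev nodes the power series of the error starts at order `M + 2`. The bound
`2 k ^ 2` for the error on `X ^ k` costs two factors of `k!`, hence the denominator `M !`. -/
lemma abs_diffRuleError_exp_le {M : ℕ} {x w : Fin (M + 2) → ℝ} {x₀ : ℝ}
    (hx : IsChebyshevNodes (-1) 1 (M + 1) x) (hx₀ : |x₀| ≤ 1)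
    (hexact : ∀ p : Polynomial ℝ, p.natDegree ≤ M + 1 → diffRuleError x w x₀ p = 0) (τ : ℝ) :
    |τ * Real.exp (τ * x₀) - ∑ m, w m * Real.exp (τ * x m)|
      ≤ 4 * |τ| ^ (M + 2) / M.factorial * Real.exp |τ| := by
  have h := hasSum_diffRuleError_exp x w x₀ τ
  have h0 : ∑ k ∈ Finset.range (M + 2),
      τ ^ k / k.factorial * diffRuleError x w x₀ (Polynomial.X ^ k) = 0 :=
    Finset.sum_eq_zero fun k hk => by
      rw [hexact _ (by simpa using Nat.lt_succ_iff.mp (Finset.mem_range.mp hk)), mul_zero]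
  rw [← hasSum_nat_add_iff' (M + 2), h0, sub_zero] at h
  have hexp : HasSum (fun k : ℕ => |τ| ^ k / k.factorial) (Real.exp |τ|) := by
    rw [Real.exp_eq_exp_ℝ]; exact NormedSpace.expSeries_div_hasSum_exp _
  rw [← Real.norm_eq_abs, ← h.tsum_eq]
  refine tsum_of_norm_bounded (hexp.mul_left _) fun k => ?_
  rw [Real.norm_eq_abs, abs_mul, abs_div, abs_pow, Nat.abs_cast]
  have h1 := abs_diffRuleError_X_pow_le (Nat.succ_ne_zero M) hx hx₀ hexact
    (k := k + (M + 2)) (by omega)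
  have h2 : ((k.factorial * M.factorial : ℕ) : ℝ) ≤ (k + M).factorial := by
    exact_mod_cast Nat.le_of_dvd (Nat.factorial_pos _)
      (Nat.factorial_mul_factorial_dvd_factorial_add k M)
  have h3 : ((k + (M + 2)).factorial : ℝ) = (k + M + 2) * (k + M + 1) * (k + M).factorial := by
    rw [← add_assoc, Nat.factorial_succ, Nat.factorial_succ]; push_cast; ring
  push_cast at h1 h2
  have hk0 : (0 : ℝ) ≤ k := k.cast_nonneg
  have hM0 : (0 : ℝ) ≤ M := M.cast_nonneg
  have hkf : (0 : ℝ) < k.factorial := by exact_mod_cast k.factorial_pos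
  have hMf : (0 : ℝ) < M.factorial := by exact_mod_cast M.factorial_pos
  have hkMf : (0 : ℝ) < (k + M).factorial := by exact_mod_cast (k + M).factorial_pos
  calc |τ| ^ (k + (M + 2)) / (k + (M + 2)).factorial
        * |diffRuleError x w x₀ (Polynomial.X ^ (k + (M + 2)))|
      ≤ |τ| ^ (k + (M + 2)) / (k + (M + 2)).factorial * (2 * ((k : ℝ) + (M + 2)) ^ 2) := by gcongr
    _ = |τ| ^ (k + (M + 2)) * (2 * ((k : ℝ) + M + 2) / (k + M + 1)) / (k + M).factorial := by
        rw [h3]; field_simp; ring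
    _ ≤ |τ| ^ (k + (M + 2)) * 4 / (k.factorial * M.factorial) := by
        gcongr
        rw [div_le_iff₀ (by positivity)]
        linarith
    _ = 4 * |τ| ^ (M + 2) / M.factorial * (|τ| ^ k / k.factorial) := by
        rw [pow_add]; field_simp

/-- Differentiation at `s` of the Lagrange interpolant at the nodes `t`, transported by the affine
map `y ↦ c + h y`, is exact up to degree `M`. -/
lemma diffRuleError_lagrange_eq_zero {M : ℕ} {t : Fin (M + 1) → ℝ} (ht : Function.Injective t)
    (s c : ℝ) {h : ℝ} (hh : h ≠ 0) (p : Polynomial ℝ) (hp : p.natDegree ≤ M) :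
    diffRuleError (fun m => (t m - c) / h)
      (fun m => h * (Polynomial.derivative (Lagrange.basis Finset.univ t m)).eval s)
      ((s - c) / h) p = 0 := by
  set ℓ : Polynomial ℝ := Polynomial.C h⁻¹ * (Polynomial.X - Polynomial.C c) with hℓ
  have hev : ∀ y, ℓ.eval y = (y - c) / h := fun y => by
    simp [hℓ]; field_simp
  have hℓ1 : ℓ.natDegree ≤ 1 := by
    rw [hℓ]
    exact (Polynomial.natDegree_C_mul_le _ _).trans (Polynomial.natDegree_X_sub_C_le _)
  have hdeg : (p.comp ℓ).degree < (Finset.univ : Finset (Fin (M + 1))).card := by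
    refine lt_of_le_of_lt Polynomial.degree_le_natDegree ?_
    rw [Finset.card_univ, Fintype.card_fin, Nat.cast_lt]
    have := Polynomial.natDegree_comp_le (p := p) (q := ℓ)
    nlinarith
  have hI := Lagrange.eq_interpolate (s := Finset.univ) (v := t) ht.injOn hdeg
  rw [Lagrange.interpolate_apply] at hI
  have hD := congrArg (fun q => (Polynomial.derivative q).eval s) hI
  simp only [Polynomial.derivative_comp, Polynomial.derivative_sum, Polynomial.eval_finsetSum,
    Polynomial.eval_mul, Polynomial.eval_comp, hev, Polynomial.derivative_C_mul,
    Polynomial.eval_C] at hD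
  have hℓ' : (Polynomial.derivative ℓ).eval s = h⁻¹ := by simp [hℓ]
  rw [hℓ'] at hD
  rw [diffRuleError_apply, sub_eq_zero]
  have : (Polynomial.derivative p).eval ((s - c) / h)
      = h * (h⁻¹ * (Polynomial.derivative p).eval ((s - c) / h)) := by field_simp
  rw [this, hD, Finset.mul_sum]
  exact Finset.sum_congr rfl fun m _ => by ring

/-- The interpolation error for the derivative of a single exponential `r ↦ exp (2 l (σ - r))`, with
a bound that is uniform over `l` bounded above. For `l < 0` the growth of the derivatives is beaten
by the decay `exp (2 l (σ - b))`: this is where the ratio `(b - a) / (2 (σ - b))` comes from. -/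
lemma abs_deriv_exp_sub_interp_le {a b σ : ℝ} (hab : a < b) (hab2 : b - a ≤ 1) (hbσ : b < σ)
    (hσ : 2 * (σ - b) ≤ 1) {M : ℕ} (hM : 1 ≤ M) {t : Fin (M + 1) → ℝ}
    (ht : IsChebyshevNodes a b M t) {s : ℝ} (hs : s ∈ Set.Icc a b) {l D : ℝ} (hD : 0 ≤ D)
    (hl : l ≤ D) :
    |-2 * l * Real.exp (2 * l * (σ - s))
        - ∑ m, (Polynomial.derivative (Lagrange.basis Finset.univ t m)).eval s
            * Real.exp (2 * l * (σ - t m))|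
      ≤ 16 / (2 * (σ - b)) * Real.exp (4 * D)
          * (((b - a) / (2 * (σ - b))) ^ M * (M : ℝ) ^ 2) := by
  obtain ⟨M, rfl⟩ : ∃ N, M = N + 1 := ⟨M - 1, by omega⟩
  set c := (a + b) / 2 with hc
  set h := (b - a) / 2 with hh
  have hpos : 0 < h := by rw [hh]; linarith
  set g := 2 * (σ - b) with hg
  have hgpos : 0 < g := by rw [hg]; linarith
  have hx := ht.normalize hab
  have hx₀ : |(s - c) / h| ≤ 1 := by
    rw [abs_div, abs_of_pos hpos, div_le_one hpos, abs_le]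
    constructor <;> linarith [hs.1, hs.2]
  have key := abs_diffRuleError_exp_le hx hx₀
    (diffRuleError_lagrange_eq_zero (ht.injective hab (Nat.succ_ne_zero M)) s c hpos.ne')
    (-2 * l * h)
  have hexp : ∀ y, Real.exp (2 * l * (σ - y))
      = Real.exp (l * (g + 2 * h)) * Real.exp (-2 * l * h * ((y - c) / h)) := fun y => by
    rw [← Real.exp_add]
    congr 1
    field_simp
    rw [hg, hh, hc]
    ring
  have heq : -2 * l * Real.exp (2 * l * (σ - s))
        - ∑ m, (Polynomial.derivative (Lagrange.basis Finset.univ t m)).eval s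
            * Real.exp (2 * l * (σ - t m))
      = Real.exp (l * (g + 2 * h)) / h * (-2 * l * h * Real.exp (-2 * l * h * ((s - c) / h))
        - ∑ m, h * (Polynomial.derivative (Lagrange.basis Finset.univ t m)).eval s
            * Real.exp (-2 * l * h * ((t m - c) / h))) := by
    simp_rw [hexp, mul_sub, Finset.mul_sum]
    congr 1
    · field_simp
    · exact Finset.sum_congr rfl fun m _ => by field_simp
  rw [heq, abs_mul, abs_of_pos (by positivity)]
  have hτ : |-2 * l * h| = 2 * h * |l| := by
    rw [abs_mul, abs_mul, abs_of_pos hpos]; norm_num; ring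
  rw [hτ] at key
  have hfac : (g * |l|) ^ (M + 2) / (M + 2).factorial ≤ Real.exp (g * |l|) :=
    Real.pow_div_factorial_le_exp _ (by positivity) _
  have hf2 : ((M + 2).factorial : ℝ) = (M + 2) * (M + 1) * M.factorial := by
    rw [Nat.factorial_succ, Nat.factorial_succ]; push_cast; ring
  have hMf : (0 : ℝ) < M.factorial := by exact_mod_cast M.factorial_pos
  have hM0 : (0 : ℝ) ≤ M := M.cast_nonneg
  have hbound : l * (g + 2 * h) + g * |l| + 2 * h * |l| ≤ 4 * D := by
    have h1 : l + |l| ≤ 2 * D := by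
      rcases abs_cases l with ⟨h', _⟩ | ⟨h', _⟩ <;> rw [h'] <;> linarith
    have h2 : 0 ≤ l + |l| := by linarith [neg_abs_le l]
    have h3 : g + 2 * h ≤ 2 := by rw [hh]; linarith
    nlinarith
  calc Real.exp (l * (g + 2 * h)) / h * _
      ≤ Real.exp (l * (g + 2 * h)) / h
          * (4 * (2 * h * |l|) ^ (M + 2) / M.factorial * Real.exp (2 * h * |l|)) := by gcongr
    _ = 8 / g * (2 * h / g) ^ (M + 1) * ((M + 2) * (M + 1))
          * (Real.exp (l * (g + 2 * h)) * ((g * |l|) ^ (M + 2) / (M + 2).factorial)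
              * Real.exp (2 * h * |l|)) := by
        rw [hf2, mul_pow, mul_pow g, div_pow, pow_succ (2 * h), pow_succ g (M + 1)]
        field_simp
        ring
    _ ≤ 8 / g * (2 * h / g) ^ (M + 1) * ((2 * (M + 1)) * (M + 1))
          * (Real.exp (l * (g + 2 * h)) * Real.exp (g * |l|) * Real.exp (2 * h * |l|)) := by
        gcongr
        linarith
    _ ≤ 8 / g * (2 * h / g) ^ (M + 1) * ((2 * (M + 1)) * (M + 1)) * Real.exp (4 * D) := by
        rw [← Real.exp_add, ← Real.exp_add]
        gcongr
    _ = _ := by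
        rw [show 2 * h = b - a by rw [hh]; ring]
        push_cast
        ring

/-! ### Differentiation under the integral sign -/

/-- Differentiation under the integral sign for exponential weights whose exponents are bounded
above: the decay `exp (2 Λ (σ - s))` leaves room to absorb the factor `Λ`. -/
lemma hasDerivAt_integral_mul_exp {α : Type*} [MeasurableSpace α] {μ : Measure α} {W Λ : α → ℝ}
    {σ D s : ℝ} (hW : Integrable W μ) (hΛ : AEMeasurable Λ μ) (hD : 0 ≤ D)
    (hΛD : ∀ᵐ p ∂μ, Λ p ≤ D) (hs : s < σ) :
    Integrable (fun p => W p * Real.exp (2 * Λ p * (σ - s))) μ ∧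
    Integrable (fun p => W p * (-2 * Λ p * Real.exp (2 * Λ p * (σ - s)))) μ ∧
    HasDerivAt (fun r => ∫ p, W p * Real.exp (2 * Λ p * (σ - r)) ∂μ)
      (∫ p, W p * (-2 * Λ p * Real.exp (2 * Λ p * (σ - s))) ∂μ) s := by
  set g := σ - s with hg
  have hgpos : 0 < g := by rw [hg]; linarith
  have hmeas : ∀ r, AEStronglyMeasurable (fun p => Real.exp (2 * Λ p * (σ - r))) μ := fun r =>
    (Real.measurable_exp.comp_aemeasurable ((hΛ.const_mul 2).mul_const _)).aestronglyMeasurable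
  have hint : Integrable (fun p => W p * Real.exp (2 * Λ p * (σ - s))) μ := by
    refine hW.mul_bdd (c := Real.exp (2 * D * g)) (hmeas s) ?_
    filter_upwards [hΛD] with p hp
    rw [Real.norm_of_nonneg (Real.exp_pos _).le]
    gcongr
  refine ⟨hint, ?_⟩
  refine hasDerivAt_integral_of_dominated_loc_of_deriv_le
    (F := fun r p => W p * Real.exp (2 * Λ p * (σ - r)))
    (F' := fun r p => W p * (-2 * Λ p * Real.exp (2 * Λ p * (σ - r))))
    (bound := fun p => ‖W p‖ * (2 / g * Real.exp (4 * g * D)))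
    (Metric.ball_mem_nhds s (half_pos hgpos))
    (Filter.Eventually.of_forall fun r => hW.aestronglyMeasurable.mul (hmeas r)) hint
    (hW.aestronglyMeasurable.mul ((hΛ.const_mul (-2)).aestronglyMeasurable.mul (hmeas s)))
    ?_ (hW.norm.mul_const _) ?_
  · filter_upwards [hΛD] with p hp r hr
    rw [Metric.mem_ball, Real.dist_eq, abs_lt] at hr
    rw [norm_mul]
    gcongr
    rw [Real.norm_eq_abs, abs_mul, abs_mul, abs_of_pos (Real.exp_pos _)]
    have h1 : |(-2 : ℝ)| * |Λ p| ≤ 2 / g * Real.exp (g * |Λ p|) := by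
      have := Real.add_one_le_exp (g * |Λ p|)
      rw [abs_neg, abs_two, div_mul_eq_mul_div, le_div_iff₀ hgpos]
      nlinarith
    have h2 : g * |Λ p| + 2 * Λ p * (σ - r) ≤ 4 * g * D := by
      have hr1 : g / 2 ≤ σ - r := by linarith
      have hr2 : σ - r ≤ 3 / 2 * g := by linarith
      rcases abs_cases (Λ p) with ⟨h', h0⟩ | ⟨h', h0⟩ <;> rw [h']
      · nlinarith [mul_le_mul_of_nonneg_left hr2 h0, mul_le_mul_of_nonneg_left hp hgpos.le]
      · have := mul_le_mul_of_nonneg_left hr1 (neg_nonneg.mpr h0.le)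
        have h4 : 0 ≤ g * D := by positivity
        nlinarith
    calc |(-2 : ℝ)| * |Λ p| * Real.exp (2 * Λ p * (σ - r))
        ≤ 2 / g * Real.exp (g * |Λ p|) * Real.exp (2 * Λ p * (σ - r)) := by gcongr
      _ = 2 / g * Real.exp (g * |Λ p| + 2 * Λ p * (σ - r)) := by rw [Real.exp_add, mul_assoc]
      _ ≤ 2 / g * Real.exp (4 * g * D) := by gcongr
  · refine Filter.Eventually.of_forall fun p r _ => ?_
    have h := (((hasDerivAt_id r).const_sub σ).const_mul (2 * Λ p)).exp.const_mul (W p)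
    convert! h using 1
    simp only [id]
    ring

/-! ### Gagliardo quotients -/

/-- The Gagliardo difference quotient `(v(x) - v(y)) / |x - y| ^ (n / 2 + s)`, with the value `0` on
the diagonal. -/
noncomputable def gagliardoQuotient {n : ℕ} (s : ℝ) (v : EuclideanSpace ℝ (Fin n) → ℝ)
    (p : EuclideanSpace ℝ (Fin n) × EuclideanSpace ℝ (Fin n)) : ℝ :=
  (v p.1 - v p.2) / ‖p.1 - p.2‖ ^ (((n : ℝ) + 2 * s) / 2)

section
variable {n : ℕ} {Ω : Set (EuclideanSpace ℝ (Fin n))}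

lemma gagliardoQuotient_sq (s : ℝ) (v : EuclideanSpace ℝ (Fin n) → ℝ)
    (p : EuclideanSpace ℝ (Fin n) × EuclideanSpace ℝ (Fin n)) :
    gagliardoQuotient s v p ^ 2
      = |v p.1 - v p.2| ^ 2 / ‖p.1 - p.2‖ ^ ((n : ℝ) + 2 * s) := by
  rw [gagliardoQuotient, div_pow, sq_abs, ← Real.rpow_mul_natCast (norm_nonneg _)]
  congr 2
  push_cast
  ring

lemma measurable_norm_sub : Measurable
    fun p : EuclideanSpace ℝ (Fin n) × EuclideanSpace ℝ (Fin n) => ‖p.1 - p.2‖ :=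
  (measurable_fst.sub measurable_snd).norm

lemma aestronglyMeasurable_gagliardoQuotient {s : ℝ} {v : EuclideanSpace ℝ (Fin n) → ℝ}
    (hv : AEStronglyMeasurable v volume) :
    AEStronglyMeasurable (gagliardoQuotient s v) volume := by
  have h1 : AEStronglyMeasurable
      (fun p : EuclideanSpace ℝ (Fin n) × EuclideanSpace ℝ (Fin n) => v p.1) volume :=
    hv.comp_quasiMeasurePreserving Measure.quasiMeasurePreserving_fst
  have h2 : AEStronglyMeasurable
      (fun p : EuclideanSpace ℝ (Fin n) × EuclideanSpace ℝ (Fin n) => v p.2) volume :=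
    hv.comp_quasiMeasurePreserving Measure.quasiMeasurePreserving_snd
  exact ((h1.sub h2).aemeasurable.div
    (measurable_norm_sub.pow_const _).aemeasurable).aestronglyMeasurable

lemma MemSobolevOmega.memLp_gagliardoQuotient {s : ℝ} {v : EuclideanSpace ℝ (Fin n) → ℝ}
    (hv : MemSobolevOmega Ω s v) : MemLp (gagliardoQuotient s v) 2 volume := by
  have hm := aestronglyMeasurable_gagliardoQuotient (s := s) hv.memLp.aestronglyMeasurable
  rw [memLp_two_iff_integrable_sq hm]
  refine ⟨hm.pow 2, ?_⟩
  rw [hasFiniteIntegral_iff_ofReal (Filter.Eventually.of_forall fun p => sq_nonneg _)]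
  simp_rw [gagliardoQuotient_sq]
  exact hv.gagliardo_lt_top

lemma sobolevOmegaNorm_eq {s : ℝ} {v : EuclideanSpace ℝ (Fin n) → ℝ}
    (hv : AEStronglyMeasurable v volume) :
    sobolevOmegaNorm s v = (∫ p, |gagliardoQuotient s v p| ^ (2 : ℝ)) ^ (1 / (2 : ℝ)) := by
  rw [sobolevOmegaNorm, Real.sqrt_eq_rpow]
  congr 1
  simp_rw [Real.rpow_two, sq_abs]
  rw [integral_eq_lintegral_of_nonneg_ae (Filter.Eventually.of_forall fun p => sq_nonneg _)
    ((aestronglyMeasurable_gagliardoQuotient hv).pow 2)]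
  simp_rw [gagliardoQuotient_sq]
  rfl

/-- Cauchy-Schwarz for the Gagliardo form of order `(s₁ + s₂) / 2`. -/
lemma MemSobolevOmega.integral_abs_mul_le {s₁ s₂ : ℝ} {u v : EuclideanSpace ℝ (Fin n) → ℝ}
    (hu : MemSobolevOmega Ω s₂ u) (hv : MemSobolevOmega Ω s₁ v) :
    ∫ p, |gagliardoQuotient s₂ u p * gagliardoQuotient s₁ v p|
      ≤ sobolevOmegaNorm s₂ u * sobolevOmegaNorm s₁ v := by
  rw [sobolevOmegaNorm_eq hu.memLp.aestronglyMeasurable,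
    sobolevOmegaNorm_eq hv.memLp.aestronglyMeasurable]
  simp_rw [abs_mul]
  have h2 : ENNReal.ofReal 2 = 2 := by simp
  exact integral_mul_le_Lp_mul_Lq_of_nonneg Real.HolderConjugate.two_two
    (Filter.Eventually.of_forall fun p => abs_nonneg _)
    (Filter.Eventually.of_forall fun p => abs_nonneg _)
    (by rw [h2]; exact hu.memLp_gagliardoQuotient.abs)
    (by rw [h2]; exact hv.memLp_gagliardoQuotient.abs)

/-- On the diagonal both sides vanish because the differences of `u` and `v` do. -/
lemma mul_div_rpow_eq_gagliardoQuotient (s₁ s₂ r : ℝ) (u v : EuclideanSpace ℝ (Fin n) → ℝ)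
    (p : EuclideanSpace ℝ (Fin n) × EuclideanSpace ℝ (Fin n)) :
    (u p.1 - u p.2) * (v p.1 - v p.2) / ‖p.1 - p.2‖ ^ ((n : ℝ) + 2 * r)
      = gagliardoQuotient s₂ u p * gagliardoQuotient s₁ v p
        * Real.exp (2 * Real.log ‖p.1 - p.2‖ * ((s₁ + s₂) / 2 - r)) := by
  rcases eq_or_ne p.1 p.2 with h | h
  · simp [gagliardoQuotient, h]
  · have hpos : 0 < ‖p.1 - p.2‖ := norm_pos_iff.mpr (sub_ne_zero.mpr h)
    simp only [gagliardoQuotient, Real.rpow_def_of_pos hpos]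
    rw [div_mul_div_comm, ← Real.exp_add, div_mul_eq_mul_div, div_eq_div_iff (Real.exp_pos _).ne'
      (Real.exp_pos _).ne', mul_assoc _ (Real.exp _) (Real.exp _), ← Real.exp_add]
    congr 2
    ring

lemma nonlocalForm_eq (s₁ s₂ r δ : ℝ) (u v : EuclideanSpace ℝ (Fin n) → ℝ) :
    nonlocalForm u v r δ = ∫ p in interactionStrip n δ,
      gagliardoQuotient s₂ u p * gagliardoQuotient s₁ v p
        * Real.exp (2 * Real.log ‖p.1 - p.2‖ * ((s₁ + s₂) / 2 - r)) := by
  simp_rw [nonlocalForm, ← mul_div_rpow_eq_gagliardoQuotient]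

lemma nonlocalFormDerivS_eq (s₁ s₂ r δ : ℝ) (u v : EuclideanSpace ℝ (Fin n) → ℝ) :
    nonlocalFormDerivS u v r δ = ∫ p in interactionStrip n δ,
      gagliardoQuotient s₂ u p * gagliardoQuotient s₁ v p
        * (-2 * Real.log ‖p.1 - p.2‖
          * Real.exp (2 * Real.log ‖p.1 - p.2‖ * ((s₁ + s₂) / 2 - r))) := by
  rw [nonlocalFormDerivS, ← integral_const_mul]
  congr 1
  funext p
  rw [mul_left_comm _ (-2 * _), ← mul_div_rpow_eq_gagliardoQuotient]
  ring

end

/-! ### The error for the nonlocal form -/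

theorem lemma5p5 (n : ℕ) (hn : 1 ≤ n) (Ω : Set (EuclideanSpace ℝ (Fin n)))
    (hΩ_open : IsOpen Ω) (hΩ_conn : IsConnected Ω) (hΩ_bdd : Bornology.IsBounded Ω)
    (δ : ℝ) (hδ : 0 < δ) (ε₀ : ℝ) (hε₀ : 0 < ε₀) :
    ∃ C : ℝ, 0 < C ∧
      ∀ smin smax s₁ s₂ : ℝ, 0 < smin → smin < smax → smax < 1 →
        s₁ ∈ Set.Ioo (0 : ℝ) 1 → s₂ ∈ Set.Ioo (0 : ℝ) 1 →
        (s₁ + s₂) / 2 - 1 / 2 < smax → smax < (s₁ + s₂) / 2 →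
        ε₀ ≤ s₁ + s₂ - 2 * smax →
      ∀ M : ℕ, 2 < M → ∀ t : Fin (M + 1) → ℝ, IsChebyshevNodes smin smax M t →
      ∀ u v : EuclideanSpace ℝ (Fin n) → ℝ,
        MemSobolevOmega Ω s₂ u → MemSobolevOmega Ω s₁ v →
      ∀ s ∈ Set.Icc smin smax,
        HasDerivAt (fun r => nonlocalForm u v r δ) (nonlocalFormDerivS u v s δ) s ∧
        |nonlocalFormDerivS u v s δ - interpFormDerivS t u v s δ|
          ≤ C * (((smax - smin) / (s₁ + s₂ - 2 * smax)) ^ M * (M : ℝ) ^ 2)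
            * sobolevOmegaNorm s₂ u * sobolevOmegaNorm s₁ v := by
  set D := Real.log (max 1 δ) with hDdef
  have hD : 0 ≤ D := Real.log_nonneg (le_max_left _ _)
  refine ⟨16 / ε₀ * Real.exp (4 * D), by positivity, ?_⟩
  intro smin smax s₁ s₂ hmin hlt hmax hs₁ hs₂ hσ1 hσ2 hε M hM t ht u v hu hv s hs
  have hmeasStrip : MeasurableSet (interactionStrip n δ) :=
    measurableSet_le measurable_norm_sub measurable_const
  set μ := (volume : Measure (EuclideanSpace ℝ (Fin n) × EuclideanSpace ℝ (Fin n))).restrict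
    (interactionStrip n δ) with hμ
  set W : EuclideanSpace ℝ (Fin n) × EuclideanSpace ℝ (Fin n) → ℝ := fun p =>
    gagliardoQuotient s₂ u p * gagliardoQuotient s₁ v p with hWdef
  have hWvol : Integrable W volume :=
    hu.memLp_gagliardoQuotient.integrable_mul hv.memLp_gagliardoQuotient
  have hW : Integrable W μ := hWvol.restrict
  set Λ : EuclideanSpace ℝ (Fin n) × EuclideanSpace ℝ (Fin n) → ℝ := fun p =>
    Real.log ‖p.1 - p.2‖ with hΛdef
  have hΛ : AEMeasurable Λ μ := (Real.measurable_log.comp measurable_norm_sub).aemeasurable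
  have hΛD : ∀ᵐ p ∂μ, Λ p ≤ D := by
    filter_upwards [ae_restrict_mem hmeasStrip] with p hp
    rcases (norm_nonneg (p.1 - p.2)).eq_or_lt with h0 | h0
    -- On the diagonal `log 0 = 0`, and `D` is nonnegative.
    · simp only [hΛdef, ← h0, Real.log_zero, hD]
    · exact Real.log_le_log h0 (le_trans hp (le_max_right _ _))
  have hder := fun r (hr : r ∈ Set.Icc smin smax) =>
    hasDerivAt_integral_mul_exp hW hΛ hD hΛD (hr.2.trans_lt hσ2)
  refine ⟨?_, ?_⟩
  · simp_rw [nonlocalForm_eq s₁ s₂, nonlocalFormDerivS_eq s₁ s₂]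
    exact (hder s hs).2.2
  · set E : ℝ := ((smax - smin) / (s₁ + s₂ - 2 * smax)) ^ M * (M : ℝ) ^ 2 with hE
    have hg0 : 0 < s₁ + s₂ - 2 * smax := by linarith
    have hE0 : 0 ≤ E := by
      have : 0 ≤ smax - smin := by linarith
      positivity
    have hpt : ∀ᵐ p ∂μ, |W p * (-2 * Λ p * Real.exp (2 * Λ p * ((s₁ + s₂) / 2 - s)))
        - ∑ m, (Polynomial.derivative (Lagrange.basis Finset.univ t m)).eval s
            * (W p * Real.exp (2 * Λ p * ((s₁ + s₂) / 2 - t m)))|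
        ≤ |W p| * (16 / ε₀ * Real.exp (4 * D) * E) := by
      filter_upwards [hΛD] with p hp
      have h := abs_deriv_exp_sub_interp_le hlt (by linarith) hσ2 (by linarith)
        (by omega : 1 ≤ M) ht hs hD hp
      rw [show 2 * ((s₁ + s₂) / 2 - smax) = s₁ + s₂ - 2 * smax by ring] at h
      simp_rw [mul_left_comm _ (W p), ← Finset.mul_sum, ← mul_sub, abs_mul (W p)]
      gcongr
      refine h.trans ?_
      gcongr
    have hsum : nonlocalFormDerivS u v s δ - interpFormDerivS t u v s δ
        = ∫ p, (W p * (-2 * Λ p * Real.exp (2 * Λ p * ((s₁ + s₂) / 2 - s)))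
        - ∑ m, (Polynomial.derivative (Lagrange.basis Finset.univ t m)).eval s
            * (W p * Real.exp (2 * Λ p * ((s₁ + s₂) / 2 - t m)))) ∂μ := by
      have hnode := fun m => ((hder (t m) (ht.mem_Icc hlt m)).1).const_mul
        ((Polynomial.derivative (Lagrange.basis Finset.univ t m)).eval s)
      rw [integral_sub (hder s hs).2.1 (integrable_finsetSum _ fun m _ => hnode m),
        integral_finsetSum _ fun m _ => hnode m, nonlocalFormDerivS_eq s₁ s₂, interpFormDerivS]
      simp_rw [nonlocalForm_eq s₁ s₂, integral_const_mul]
      rfl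
    rw [hsum, ← Real.norm_eq_abs]
    calc _ ≤ ∫ p, |W p| * (16 / ε₀ * Real.exp (4 * D) * E) ∂μ :=
          norm_integral_le_of_norm_le (hW.abs.mul_const _) hpt
      _ = (∫ p, |W p| ∂μ) * (16 / ε₀ * Real.exp (4 * D) * E) := integral_mul_const _ _
      _ ≤ (∫ p, |W p|) * (16 / ε₀ * Real.exp (4 * D) * E) := by
          gcongr
          · exact Filter.Eventually.of_forall fun p => abs_nonneg _
          · exact hWvol.abs
          · exact Measure.restrict_le_self
      _ ≤ (sobolevOmegaNorm s₂ u * sobolevOmegaNorm s₁ v)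
            * (16 / ε₀ * Real.exp (4 * D) * E) := by
          gcongr
          exact hu.integral_abs_mul_le hv
      _ = _ := by ring
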